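/- Let $\mathfrak{c}=2^{\aleph_0}$. A zero set of $\mathbb{R}$ is a set of the form $\{x\in\mathbb{R} : f(x)=0\}$ with $f:\mathbb{R}\to\mathbb{R}$ continuous; let $\mathbf{Z}[\mathbb{R}]$ be the family of all zero sets of $\mathbb{R}$. A $z$-filter on $\mathbb{R}$ is a non-empty proper subset $\mathcal{F}$ of $\mathbf{Z}[\mathbb{R}]$ such that $Z_1\cap Z_2\in\mathcal{F}$ whenever $Z_1,Z_2\in\mathcal{F}$, and $Z_2\in\mathcal{F}$ whenever $Z_1\in\mathcal{F}$, $Z_2\in\mathbf{Z}[\mathbb{R}]$ and $Z_1\subseteq Z_2$. A $z$-filter $\mathcal{P}$ is prime if $Z_1\cup Z_2\notin\mathcal{P}$ whenever $Z_1,Z_2\in\mathbf{Z}[\mathbb{R}]\setminus\mathcal{P}$. Let $\kappa$ be any ordinal of cardinality $\mathfrak{c}$. Then there exists a well-ordered increasing chain of order type $\kappa$ of prime $z$-filters on $\mathbb{R}$, that is, a family $(\mathcal{Q}_\alpha)_{\alpha<\kappa}$ of prime $z$-filters on $\mathbb{R}$ such that $\mathcal{Q}_\alpha\subsetneq\mathcal{Q}_\beta$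 whenever $\alpha<\beta<\kappa$. -/

import Mathlib

/-- The family of zero sets of a topological space `X`: all sets of the form `{x | f x = 0}`
with `f` a continuous real-valued function on `X`. -/
def zeroSets (X : Type*) [TopologicalSpace X] : Set (Set X) :=
  {Z | ∃ f : C(X, ℝ), Z = {x | f x = 0}}

/-- A `z`-filter on `X`: a non-empty proper subset of the family of zero sets of `X` that is
closed under finite intersections and under supersets (among zero sets). -/
structure IsZFilter {X : Type*} [TopologicalSpace X] (F : Set (Set X)) : Prop where
  nonempty : F.Nonempty
  ssubset_zeroSets : F ⊂ zeroSets X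
  inter_mem : ∀ Z₁ ∈ F, ∀ Z₂ ∈ F, Z₁ ∩ Z₂ ∈ F
  mem_of_superset : ∀ Z₁ ∈ F, ∀ Z₂ ∈ zeroSets X, Z₁ ⊆ Z₂ → Z₂ ∈ F

/-- A prime `z`-filter on `X`: a `z`-filter such that the union of two zero sets outside of it
is again outside of it. -/
structure IsPrimeZFilter {X : Type*} [TopologicalSpace X] (P : Set (Set X)) : Prop
    extends IsZFilter P where
  union_notMem : ∀ Z₁ ∈ zeroSets X, ∀ Z₂ ∈ zeroSets X, Z₁ ∉ P → Z₂ ∉ P → Z₁ ∪ Z₂ ∉ P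

open Filter Topology

/-! Embed the Cantor space in `ℝ` and take continuum many almost disjoint infinite sets `A i ⊆ ℕ`.
The images `Z i` of the closed sets of points vanishing on `A i` serve as separators: the aim is `Z
i ∈ Q j ↔ i < j`. An ultrafilter limit over finite index sets (`exists_strictMono_isPrimeZFilter`)
reduces this to finitely many `i`. There, bits in one `A i` are switched on ever farther out: this
loses `Z i`, gains no closed set and, by almost disjointness, leaves the other `Z i'` alone. -/

/-- A closed subset of a metric space is a zero set. -/
theorem IsClosed.mem_zeroSets {X : Type*} [PseudoMetricSpace X] {C : Set X} (hC : IsClosed C) :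
    C ∈ zeroSets X := by
  rcases C.eq_empty_or_nonempty with rfl | hne
  · exact ⟨ContinuousMap.const X 1, by simp⟩
  · refine ⟨⟨fun x => Metric.infDist x C, Metric.continuous_infDist_pt C⟩, ?_⟩
    ext x
    exact hC.mem_iff_infDist_zero hne

theorem isClosed_of_mem_zeroSets {X : Type*} [TopologicalSpace X] {C : Set X}
    (hC : C ∈ zeroSets X) : IsClosed C := by
  obtain ⟨f, rfl⟩ := hC
  exact isClosed_eq f.continuous continuous_const

theorem inter_mem_zeroSets {X : Type*} [PseudoMetricSpace X] {C D : Set X}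
    (hC : C ∈ zeroSets X) (hD : D ∈ zeroSets X) : C ∩ D ∈ zeroSets X :=
  ((isClosed_of_mem_zeroSets hC).inter (isClosed_of_mem_zeroSets hD)).mem_zeroSets

/-- The zero sets that belong to an ultrafilter form a prime `z`-filter. -/
theorem Ultrafilter.isPrimeZFilter {X : Type*} [PseudoMetricSpace X] (U : Ultrafilter X) :
    IsPrimeZFilter {C | C ∈ zeroSets X ∧ C ∈ U} where
  nonempty := ⟨Set.univ, isClosed_univ.mem_zeroSets, Filter.univ_mem⟩
  ssubset_zeroSets := ⟨fun _ h => h.1, fun h =>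
    U.empty_notMem (h (isClosed_empty.mem_zeroSets)).2⟩
  inter_mem := fun _ h₁ _ h₂ => ⟨inter_mem_zeroSets h₁.1 h₂.1, Filter.inter_mem h₁.2 h₂.2⟩
  mem_of_superset := fun _ h₁ _ h₂ h => ⟨h₂, Filter.mem_of_superset h₁.2 h⟩
  union_notMem := by
    rintro C hC D hD hCU hDU ⟨-, h⟩
    exact (Ultrafilter.union_mem_iff.1 h).elim (fun h => hCU ⟨hC, h⟩) (fun h => hDU ⟨hD, h⟩)

/-- The limit of a family of prime `z`-filters along an ultrafilter is a prime `z`-filter. -/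
theorem IsPrimeZFilter.eventually_mem {X I : Type*} [PseudoMetricSpace X] (𝒰 : Ultrafilter I)
    {P : I → Set (Set X)} (hP : ∀ i, IsPrimeZFilter (P i)) :
    IsPrimeZFilter {C | C ∈ zeroSets X ∧ ∀ᶠ i in 𝒰, C ∈ P i} where
  nonempty := by
    refine ⟨Set.univ, isClosed_univ.mem_zeroSets, Eventually.of_forall fun i => ?_⟩
    obtain ⟨C, hC⟩ := (hP i).nonempty
    exact (hP i).mem_of_superset C hC _ isClosed_univ.mem_zeroSets (Set.subset_univ _)
  ssubset_zeroSets := by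
    refine ⟨fun _ h => h.1, fun h => ?_⟩
    obtain ⟨i, hi⟩ := (h (isClosed_empty.mem_zeroSets)).2.exists
    exact (hP i).ssubset_zeroSets.2 fun C hC =>
      (hP i).mem_of_superset _ hi C hC (Set.empty_subset _)
  inter_mem := fun C h₁ D h₂ => ⟨inter_mem_zeroSets h₁.1 h₂.1, by
    filter_upwards [h₁.2, h₂.2] with i hC hD using (hP i).inter_mem C hC D hD⟩
  mem_of_superset := fun C h₁ D h₂ h => ⟨h₂, by
    filter_upwards [h₁.2] with i hC using (hP i).mem_of_superset C hC D h₂ h⟩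
  union_notMem := by
    rintro C hC D hD hCU hDU ⟨-, h⟩
    have hC' : ∀ᶠ i in 𝒰, C ∉ P i := Ultrafilter.eventually_not.2 fun h => hCU ⟨hC, h⟩
    have hD' : ∀ᶠ i in 𝒰, D ∉ P i := Ultrafilter.eventually_not.2 fun h => hDU ⟨hD, h⟩
    obtain ⟨i, h, hCi, hDi⟩ := (h.and (hC'.and hD')).exists
    exact (hP i).union_notMem C hC D hD hCi hDi h

/-- A compactness principle: a strictly increasing family of prime `z`-filters that is separated
by given zero sets exists as soon as each finite set of the separation conditions can be met. -/
theorem exists_strictMono_isPrimeZFilter {X ι : Type*} [PseudoMetricSpace X] [LinearOrder ι]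
    (Z : ι → Set X) (hZ : ∀ i, Z i ∈ zeroSets X)
    (h : ∀ F : Finset ι, ∃ P : ι → Set (Set X), (∀ i, IsPrimeZFilter (P i)) ∧ Monotone P ∧
      ∀ i ∈ F, ∀ j, Z i ∈ P j ↔ i < j) :
    ∃ Q : ι → Set (Set X), (∀ i, IsPrimeZFilter (Q i)) ∧ StrictMono Q := by
  choose P hP hmono hsep using h
  let 𝒰 : Ultrafilter (Finset ι) := Ultrafilter.of atTop
  have hev : ∀ i, ∀ᶠ F : Finset ι in 𝒰, i ∈ F := fun i =>
    Ultrafilter.of_le atTop <| (eventually_ge_atTop {i}).mono fun F hF =>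
      hF (Finset.mem_singleton_self i)
  refine ⟨fun j => {C | C ∈ zeroSets X ∧ ∀ᶠ F in 𝒰, C ∈ P F j},
    fun j => IsPrimeZFilter.eventually_mem 𝒰 fun F => hP F j, fun i j hij => ⟨?_, fun hle => ?_⟩⟩
  · exact fun C hC => ⟨hC.1, hC.2.mono fun F hF => hmono F hij.le hF⟩
  · have hj : ∀ᶠ F in 𝒰, Z i ∈ P F j := (hev i).mono fun F hF => (hsep F i hF j).2 hij
    obtain ⟨F, hF, hiF⟩ := ((hle ⟨hZ i, hj⟩).2.and (hev i)).exists
    exact lt_irrefl i ((hsep F i hiF i).1 hF)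

/-- There are continuum many infinite subsets of `ℕ`, given by their enumerations, that are
pairwise almost disjoint. -/
theorem exists_almostDisjoint :
    ∃ g : (ℕ → Bool) → ℕ → ℕ, (∀ x, Function.Injective (g x)) ∧
      ∀ x y, x ≠ y → ∀ᶠ k in atTop, ∀ l, g x k ≠ g y l := by
  -- Codes of the initial segments of a branch of the binary tree: distinct branches share only
  -- finitely many nodes.
  refine ⟨fun x k => Encodable.encode (List.ofFn fun i : Fin k => x i), fun x k l h => ?_,
    fun x y hxy => ?_⟩
  · simpa using congrArg List.length (Encodable.encode_injective h)
  · obtain ⟨n, hn⟩ := Function.ne_iff.1 hxy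
    filter_upwards [eventually_gt_atTop n] with k hk l h
    have h' := Encodable.encode_injective h
    obtain rfl : k = l := by simpa using congrArg List.length h'
    exact hn (congrFun (List.ofFn_injective h') ⟨n, hk⟩)

/-- The closed set of those points of the Cantor space that vanish on the range of `g`. -/
def vanishingOn (g : ℕ → ℕ) : Set (ℕ → Bool) := {y | ∀ k, y (g k) = false}

theorem isClosed_vanishingOn (g : ℕ → ℕ) : IsClosed (vanishingOn g) := by
  simp only [vanishingOn, Set.ofPred_forall]
  exact isClosed_iInter fun k => isClosed_eq (continuous_apply _) continuous_const

/-- Switching on a far-away bit from the range of `g` moves an ultrafilter on the Cantor space to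
one that has fewer closed sets, off `vanishingOn g`, but unchanged with respect to the sets
`vanishingOn g'` with `g'` almost disjoint from `g`. -/
theorem exists_ultrafilter_notMem_vanishingOn {g : ℕ → ℕ} (hg : Function.Injective g)
    (U : Ultrafilter (ℕ → Bool)) :
    ∃ V : Ultrafilter (ℕ → Bool), (∀ C, IsClosed C → C ∈ V → C ∈ U) ∧ vanishingOn g ∉ V ∧
      ∀ g' : ℕ → ℕ, (∀ᶠ k in atTop, ∀ l, g k ≠ g' l) →
        (vanishingOn g' ∈ V ↔ vanishingOn g' ∈ U) := by
  let 𝒱 : Ultrafilter ℕ := hyperfilter ℕ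
  have h𝒱 : (𝒱 : Filter ℕ) ≤ atTop := Nat.hyperfilter_le_atTop
  let V : Ultrafilter (ℕ → Bool) :=
    U.bind fun y => 𝒱.map fun k => Function.update y (g k) true
  have mem_V : ∀ C : Set (ℕ → Bool),
      C ∈ V ↔ ∀ᶠ y in U, ∀ᶠ k in 𝒱, Function.update y (g k) true ∈ C := fun C => Iff.rfl
  have anti : ∀ C, IsClosed C → C ∈ V → C ∈ U := by
    intro C hC hCV
    by_contra hCU
    rw [← Ultrafilter.compl_mem_iff_notMem] at hCU
    obtain ⟨y, hy, hyC⟩ := (((mem_V C).1 hCV).and hCU).exists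
    have hlim : Tendsto (fun k => Function.update y (g k) true) 𝒱 (𝓝 y) := by
      refine tendsto_pi_nhds.2 fun n => tendsto_nhds_of_eventually_eq ?_
      have hne : ∀ᶠ k in atTop, g k ≠ n := hg.nat_tendsto_atTop.eventually_ne_atTop n
      filter_upwards [h𝒱 hne] with k hk using Function.update_of_ne (Ne.symm hk) _ _
    exact hyC (hC.mem_of_tendsto hlim hy)
  refine ⟨V, anti, fun h => ?_, fun g' hg' => ⟨anti _ (isClosed_vanishingOn g'), fun h => ?_⟩⟩
  · obtain ⟨y, hy⟩ := ((mem_V _).1 h).exists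
    obtain ⟨k, hk⟩ := hy.exists
    simpa using hk k
  · refine (mem_V _).2 (Eventually.mono h fun y hy => (hg'.filter_mono h𝒱).mono fun k hk l => ?_)
    rw [Function.update_of_ne (hk l).symm]
    exact hy l

/-- For a family of pairwise almost disjoint sequences, any finite set of the associated closed
sets `vanishingOn (g i)` separates some increasing family of ultrafilters. -/
theorem exists_ultrafilter_family {ι : Type*} [LinearOrder ι] {g : ι → ℕ → ℕ}
    (hg : ∀ i, Function.Injective (g i))
    (hd : ∀ i j, i ≠ j → ∀ᶠ k in atTop, ∀ l, g i k ≠ g j l) (F : Finset ι) :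
    ∃ W : ι → Ultrafilter (ℕ → Bool),
      (∀ i j, i ≤ j → ∀ C, IsClosed C → C ∈ W i → C ∈ W j) ∧
      ∀ i j, vanishingOn (g i) ∈ W j ↔ (i ∈ F → i < j) := by
  induction F using Finset.induction_on_min with
  | empty =>
    -- The zero point lies in every `vanishingOn (g i)`.
    refine ⟨fun _ => pure fun _ => false, fun _ _ _ _ _ h => h, fun i j => ?_⟩
    simp [vanishingOn]
  | insert a F ha ih =>
    obtain ⟨W, hW, hsep⟩ := ih
    obtain ⟨V, hVW, haV, hV⟩ := exists_ultrafilter_notMem_vanishingOn (hg a) (W a)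
    -- `a` lies below all of `F`, so for `j ≤ a` no condition `i < j` with `i ∈ F` holds, and one
    -- `V` built from `W a` serves all these `j`.
    refine ⟨fun j => if j ≤ a then V else W j, fun i j hij C hC h => ?_, fun i j => ?_⟩
    · by_cases hj : j ≤ a
      · simpa [hj, hij.trans hj] using h
      · by_cases hi : i ≤ a
        · simp only [hi, hj, if_true, if_false] at h ⊢
          exact hW a j (not_le.1 hj).le C hC (hVW C hC h)
        · simp only [hi, hj, if_false] at h ⊢
          exact hW i j hij C hC h
    · by_cases hia : i = a
      · subst hia
        have hiF : i ∉ F := fun h => lt_irrefl i (ha i h)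
        by_cases hj : j ≤ i
        · simp [hj, haV]
        · simp [hj, hsep, hiF, not_le.1 hj]
      · by_cases hj : j ≤ a
        · simp only [hj, if_true, hV (g i) (hd a i (Ne.symm hia)), hsep, Finset.mem_insert, hia,
            false_or]
          exact forall_congr' fun hi => ⟨fun h => absurd h (ha i hi).not_gt,
            fun h => h.trans_le hj⟩
        · simp [hj, hsep, hia]

theorem corollary5p7 (κ : Ordinal) (hκ : κ.card = Cardinal.continuum) :
    ∃ Q : Set.Iio κ → Set (Set ℝ), (∀ α, IsPrimeZFilter (Q α)) ∧ StrictMono Q := by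
  obtain ⟨x, hx⟩ : ∃ x : Set.Iio κ → ℕ → Bool, Function.Injective x := by
    have hle : Cardinal.lift.{0} (Cardinal.mk (Set.Iio κ)) ≤
        Cardinal.lift (Cardinal.mk (ℕ → Bool)) := by
      simp [Cardinal.mk_Iio_ordinal, hκ]
    obtain ⟨f⟩ := Cardinal.lift_mk_le'.1 hle
    exact ⟨f, f.injective⟩
  obtain ⟨g, hg, hd⟩ := exists_almostDisjoint
  obtain ⟨e, -, hec, hei⟩ := (isClosed_univ (X := ℝ)).exists_nat_bool_injection_of_not_countable
    Set.not_countable_univ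
  refine exists_strictMono_isPrimeZFilter (fun α => e '' vanishingOn (g (x α)))
    (fun α => ((isClosed_vanishingOn _).isCompact.image hec).isClosed.mem_zeroSets) fun F => ?_
  obtain ⟨W, hW, hsep⟩ := exists_ultrafilter_family (g := fun α => g (x α)) (fun α => hg (x α))
    (fun α β hαβ => hd _ _ (hx.ne hαβ)) F
  refine ⟨fun α => {C | C ∈ zeroSets ℝ ∧ C ∈ (W α).map e}, fun α => ((W α).map e).isPrimeZFilter,
    -- `W` increases only on closed sets, which suffices as zero sets pull back to closed sets.
    fun α β hαβ C hC => ⟨hC.1, hW α β hαβ _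
      ((isClosed_of_mem_zeroSets hC.1).preimage hec) hC.2⟩, fun α hα β => ?_⟩
  have hZ : e '' vanishingOn (g (x α)) ∈ zeroSets ℝ :=
    ((isClosed_vanishingOn _).isCompact.image hec).isClosed.mem_zeroSets
  have h := hsep α β
  simp only [hα, true_imp_iff] at h
  simp only [Set.mem_ofPred_eq, hZ, true_and, Ultrafilter.mem_map, hei.preimage_image]
  exact h
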